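/- Let $r,s\ge 0$ be integers such that $w=r+s$ is even and $w>0$. For $z$ in the upper half-plane $\mathfrak H$ put $q=e^{2\pi i z}$ and $\mathbb L=\log|q|=-2\pi\,\mathrm{Im}(z)$, and let $$\mathcal E_{r,s}(z)=\frac{w!}{(2\pi i)^{w+2}}\,\frac12\sum_{(m,n)\in\mathbb Z^2\setminus\{(0,0)\}}\frac{\mathbb L}{(mz+n)^{r+1}(m\overline z+n)^{s+1}}$$ be the real analytic Eisenstein series (the series converges absolutely). Then $\mathcal E_{r,s}$ has a unique expansion in $\mathbb C[[q,\overline q]][\mathbb L^{\pm1}]$, that is, an expansion $$\mathcal E_{r,s}=\sum_{k=-N}^{N}\ \sum_{m,n\ge 0}a^{(k)}_{m,n}\,\mathbb L^k q^m\overline q^{\,n}\qquad (a^{(k)}_{m,n}\in\mathbb C)$$ for some $N\in\mathbb N$, absolutely convergent for every $z\in\mathfrak H$. Its constant part $\mathcal E_{r,s}^0:=\sum_k a^{(k)}_{0,0}\mathbb L^k\in\mathbb C[\mathbb L^{\pm1}]$ is $$\mathcal E_{r,s}^0=\frac{-B_{w+2}}{2(w+1)(w+2)}\,\mathbb L+\frac{(-1)^s}{2}\,\frac{w!}{2^w}\binom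 wr\,\zeta(w+1)\,\mathbb L^{-w},$$ where $B_{w+2}$ is the Bernoulli number and $\zeta$ is the Riemann zeta function, and $\mathcal E_{r,s}-\mathcal E_{r,s}^0$ has rational coefficients: $a^{(k)}_{m,n}\in\mathbb Q$ for all $k$ and all $(m,n)\ne(0,0)$. -/

import Mathlib

open UpperHalfPlane ComplexConjugate

/-- `𝕃(z) = log |q| = i π (z - z̄) = -2 π Im z`. -/
noncomputable def LL (z : ℍ) : ℂ := ((-2 * Real.pi * z.im : ℝ) : ℂ)

/-- The nome `q = exp (2 π i z)`. -/
noncomputable def nome (z : ℍ) : ℂ := Complex.exp (2 * Real.pi * Complex.I * (z : ℂ))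

/-- The `(m, n)`-th term `𝕃 / ((m z + n) ^ (r + 1) (m z̄ + n) ^ (s + 1))` of the lattice sum. -/
noncomputable def eisTerm (r s : ℕ) (z : ℍ) (p : ℤ × ℤ) : ℂ :=
  LL z / (((p.1 : ℂ) * (z : ℂ) + (p.2 : ℂ)) ^ (r + 1) *
    ((p.1 : ℂ) * conj (z : ℂ) + (p.2 : ℂ)) ^ (s + 1))

/-- The real analytic Eisenstein series `ℰ_{r,s}`: with `w = r + s`, it is
`w! / (2 π i) ^ (w + 2) * (1 / 2)` times the sum of `eisTerm` over `(m, n) ≠ (0, 0)`. -/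
noncomputable def realEis (r s : ℕ) (z : ℍ) : ℂ :=
  ((r + s).factorial : ℂ) / (2 * Real.pi * Complex.I) ^ (r + s + 2) * (1 / 2) *
    ∑' p : {p : ℤ × ℤ // p ≠ (0, 0)}, eisTerm r s z p

/-- `a` is an expansion of `f` in `ℂ[[q, q̄]][𝕃^±]`: for all `z`,
`f z = ∑ₖ ∑_{m, n ≥ 0} a k (m, n) 𝕃 ^ k q ^ m q̄ ^ n`, where only finitely many `k ∈ ℤ` occur
and for each `k` the double series in `q, q̄` converges absolutely. -/
def IsQExpansion (f : ℍ → ℂ) (a : ℤ →₀ (ℕ × ℕ → ℂ)) : Prop :=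
  ∀ z : ℍ,
    (∀ k : ℤ, Summable fun p : ℕ × ℕ => a k p * nome z ^ p.1 * conj (nome z) ^ p.2) ∧
    f z = a.sum fun k c => LL z ^ k * ∑' p : ℕ × ℕ, c p * nome z ^ p.1 * conj (nome z) ^ p.2

/-- The constant part `∑ₖ a k (0, 0) 𝕃 ^ k ∈ ℂ[𝕃^±]` of an expansion; the variable of the Laurent
polynomial ring is `𝕃`. -/
noncomputable def constantPart (a : ℤ →₀ (ℕ × ℕ → ℂ)) : LaurentPolynomial ℂ :=
  a.sum fun k c => LaurentPolynomial.C (c (0, 0)) * LaurentPolynomial.T k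

/-! Existence. Summing the lattice by rows, row `m = 0` gives `ζ(w + 2)`, rows `m` and `-m` agree
because `w` is even, and row `m ≥ 1` is a sum over `n` at the point `τ = m z`. Since `(τ + n) - (τ̄
+ n) = 𝕃(τ) / (π i)` does not depend on `n`, partial fractions (`rowTerm_succ_succ`) lower the
exponents until a pure power remains, summed by the Lipschitz formula, or the exponents are `(1,
1)`, summed by the cotangent series. Every row sum is then `(2 π i) ^ (w + 2)` times an expression
with rational coefficients (`exists_tsum_rowTerm_eq`), and the normalisation of `realEis` cancels
that power. Summing over `m` turns the constant terms into `ζ(w + 1)` and the rest into Lambert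
series with rational coefficients.

Uniqueness. For the difference of two expansions put `q = u e ^ (-y)` with `|u| = 1`, so `𝕃 = -y`.
As `y → ∞`, powers of `y` and of `e ^ (-y)` separate (`coeff_eq_zero_of_sum_log_pow`), leaving for
each degree a homogeneous polynomial in `u, ū` that vanishes on the circle, hence is zero
(`coeff_eq_zero_of_circle`). -/

/-! ### Row sums of the lattice -/

lemma upperHalfPlane_add_int_ne_zero (τ : ℍ) (n : ℤ) : (τ : ℂ) + n ≠ 0 := by
  intro h
  have := congrArg Complex.im h
  simp at this
  exact τ.im_ne_zero this

lemma conj_upperHalfPlane_add_int_ne_zero (τ : ℍ) (n : ℤ) : conj (τ : ℂ) + n ≠ 0 := by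
  intro h
  apply upperHalfPlane_add_int_ne_zero τ n
  simpa using congrArg conj h

lemma LL_ne_zero (τ : ℍ) : LL τ ≠ 0 := by
  simp [LL, Real.pi_ne_zero, τ.im_ne_zero]

lemma norm_nome_lt_one (τ : ℍ) : ‖nome τ‖ < 1 := norm_exp_two_pi_I_lt_one τ

lemma norm_conj_nome_lt_one (τ : ℍ) : ‖conj (nome τ)‖ < 1 := by
  rw [Complex.norm_conj]; exact norm_nome_lt_one τ

lemma LL_eq_sub_conj (τ : ℍ) :
    LL τ = Real.pi * Complex.I * ((τ : ℂ) - conj (τ : ℂ)) := by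
  rw [Complex.sub_conj, LL]
  push_cast
  rw [coe_im]
  linear_combination (2 * Real.pi * (τ.im : ℂ)) * (-Complex.I_sq)

/-- The `n`-th term of the sum over a row of the lattice. -/
noncomputable def rowTerm (a b : ℕ) (τ : ℍ) (n : ℤ) : ℂ :=
  (((τ : ℂ) + n) ^ a * (conj (τ : ℂ) + n) ^ b)⁻¹

lemma conj_rowTerm (a b : ℕ) (τ : ℍ) (n : ℤ) : conj (rowTerm a b τ n) = rowTerm b a τ n := by
  simp [rowTerm, mul_comm]

lemma summable_rowTerm {a b : ℕ} (h : 2 ≤ a + b) (τ : ℍ) : Summable (rowTerm a b τ) := by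
  apply EisensteinSeries.summable_inv_of_isBigO_rpow_inv (a := ((a + b : ℕ) : ℝ))
    (by exact_mod_cast h)
  have h1 := (EisensteinSeries.linear_inv_isBigO_right 1 (τ : ℂ)).abs_right.pow a
  have h2 := (EisensteinSeries.linear_inv_isBigO_right 1 (conj (τ : ℂ))).abs_right.pow b
  refine (h1.mul h2).congr (fun n => ?_) (fun n => ?_)
  · simp [mul_comm]
  · rw [Real.rpow_natCast, pow_add, mul_inv, abs_inv, inv_pow, inv_pow]

/-- The inverse of `τ - τ̄` is `2 π i / (2 𝕃)`. -/
lemma inv_sub_conj (τ : ℍ) :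
    ((τ : ℂ) - conj (τ : ℂ))⁻¹ = 2 * Real.pi * Complex.I * (2 * LL τ)⁻¹ := by
  have h := LL_ne_zero τ
  rw [LL_eq_sub_conj] at h ⊢
  have h1 := right_ne_zero_of_mul h
  have h2 := left_ne_zero_of_mul h
  field_simp

/-- Partial fractions: `1 / (A B) = (1 / B - 1 / A) / (A - B)` with `A - B = τ - τ̄` the same for
all `n`. -/
lemma rowTerm_succ_succ (a b : ℕ) (τ : ℍ) (n : ℤ) :
    rowTerm (a + 1) (b + 1) τ n = 2 * Real.pi * Complex.I * (2 * LL τ)⁻¹ *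
      (rowTerm a (b + 1) τ n - rowTerm (a + 1) b τ n) := by
  have hA := upperHalfPlane_add_int_ne_zero τ n
  have hB := conj_upperHalfPlane_add_int_ne_zero τ n
  have hd : (τ : ℂ) - conj (τ : ℂ) ≠ 0 := by
    intro h
    apply LL_ne_zero τ
    rw [LL_eq_sub_conj, h, mul_zero]
  rw [← inv_sub_conj]
  unfold rowTerm
  generalize conj (τ : ℂ) = t at *
  field_simp
  ring

/-- The sum `∑ d ^ k x ^ d` over `d ≥ 1`. -/
noncomputable def powSum (k : ℕ) (x : ℂ) : ℂ := ∑' d : ℕ+, (d : ℂ) ^ k * x ^ (d : ℕ)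

lemma conj_powSum (k : ℕ) (x : ℂ) : conj (powSum k x) = powSum k (conj x) := by
  simp [powSum, Complex.conj_tsum]

/-- The Lipschitz formula. -/
lemma tsum_rowTerm_zero_right (N : ℕ) (τ : ℍ) :
    ∑' n, rowTerm (N + 2) 0 τ n =
      (2 * Real.pi * Complex.I) ^ (N + 2) *
        (((-1) ^ N / ((N + 1).factorial : ℚ) : ℚ) * powSum (N + 1) (nome τ)) := by
  have h := EisensteinSeries.qExpansion_identity_pnat (k := N + 1) (by omega) τ
  simp only [rowTerm, pow_zero, mul_one, powSum, nome]
  simp only [one_div] at h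
  rw [h]
  push_cast
  rw [show (-2 * Real.pi * Complex.I : ℂ) = (-1) * (2 * Real.pi * Complex.I) by ring, mul_pow]
  ring

lemma tsum_rowTerm_zero_left (N : ℕ) (τ : ℍ) :
    ∑' n, rowTerm 0 (N + 2) τ n =
      (2 * Real.pi * Complex.I) ^ (N + 2) *
        ((1 / ((N + 1).factorial : ℚ) : ℚ) * powSum (N + 1) (conj (nome τ))) := by
  have h := congrArg conj (tsum_rowTerm_zero_right N τ)
  simp only [Complex.conj_tsum, conj_rowTerm, map_mul, map_pow, conj_powSum] at h
  rw [h]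
  simp only [map_ofNat, Complex.conj_ofReal, Complex.conj_I, map_ratCast]
  rw [show (2 * Real.pi * -Complex.I : ℂ) = (-1) * (2 * Real.pi * Complex.I) by ring, mul_pow]
  push_cast
  have h1 : ((-1 : ℂ) ^ N) * (-1) ^ N = 1 := by rw [← mul_pow]; simp
  linear_combination (2 * Real.pi * Complex.I : ℂ) ^ (N + 2) * powSum (N + 1) (conj (nome τ)) /
    ((N + 1).factorial : ℂ) * h1

lemma pi_mul_cot_eq_powSum (τ : ℍ) :
    Real.pi * Complex.cot (Real.pi * τ) =
      -(Real.pi * Complex.I) - 2 * Real.pi * Complex.I * powSum 0 (nome τ) := by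
  have hs : Summable (fun n : ℕ => Complex.exp (2 * Real.pi * Complex.I * τ) ^ n) :=
    summable_geometric_of_norm_lt_one (norm_exp_two_pi_I_lt_one τ)
  rw [pi_mul_cot_pi_q_exp, ← tsum_zero_pnat_eq_tsum_nat hs]
  simp only [powSum, nome, pow_zero, one_mul]
  ring

/-- Partial fractions leave series `∑ 1 / (τ + n)` that do not converge absolutely, so `n` and `-n`
are paired as in the cotangent expansion. Its constant `-π i` and the conjugate `π i` differ by `2 π
i`: this is the origin of the constant term. -/
lemma tsum_rowTerm_one_one (τ : ℍ) :
    ∑' n, rowTerm 1 1 τ n = (2 * Real.pi * Complex.I) ^ 2 * ((2 * LL τ)⁻¹ *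
      (1 + powSum 0 (nome τ) + powSum 0 (conj (nome τ)))) := by
  have hτ := UpperHalfPlane.coe_mem_integerComplement τ
  have hsum : Summable (fun n : ℕ+ => (1 / ((τ : ℂ) - n) + 1 / ((τ : ℂ) + n))) :=
    (summable_pnat_iff_summable_succ (f := fun n : ℕ => 1 / ((τ : ℂ) - n) + 1 / ((τ : ℂ) + n))).2
      ((summable_cotTerm hτ).congr fun n => by simp [cotTerm])
  have hcot : HasSum (fun n : ℕ+ => (1 / ((τ : ℂ) - n) + 1 / ((τ : ℂ) + n)))
      (-(Real.pi * Complex.I) - 2 * Real.pi * Complex.I * powSum 0 (nome τ) - 1 / τ) := by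
    rw [← pi_mul_cot_eq_powSum, cot_series_rep hτ, add_sub_cancel_left]
    exact hsum.hasSum
  have hconj := Complex.hasSum_conj'.2 hcot
  have h := ((hconj.sub hcot).mul_left (2 * Real.pi * Complex.I * (2 * LL τ)⁻¹)).tsum_eq
  have hrow := summable_rowTerm (a := 1) (b := 1) le_rfl τ
  have hpos : Summable fun n : ℕ+ => rowTerm 1 1 τ n :=
    hrow.comp_injective (i := fun n : ℕ+ => ((n : ℕ) : ℤ)) fun m n h => by simpa using h
  have hneg : Summable fun n : ℕ+ => rowTerm 1 1 τ (-n) :=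
    hrow.comp_injective (i := fun n : ℕ+ => -((n : ℕ) : ℤ)) fun m n h => by simpa using h
  rw [tsum_int_eq_zero_add_tsum_pnat hrow, add_assoc, ← hpos.tsum_add hneg]
  have h0 : ∀ n : ℤ, rowTerm 1 1 τ n = 2 * Real.pi * Complex.I * (2 * LL τ)⁻¹ *
      (1 / (conj (τ : ℂ) + n) - 1 / ((τ : ℂ) + n)) := fun n => by
    rw [rowTerm_succ_succ 0 0]; simp [rowTerm]
  have h1 : ∀ n : ℕ+, rowTerm 1 1 τ n + rowTerm 1 1 τ (-n) =
      2 * Real.pi * Complex.I * (2 * LL τ)⁻¹ *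
      (conj (1 / ((τ : ℂ) - n) + 1 / ((τ : ℂ) + n)) - (1 / ((τ : ℂ) - n) + 1 / ((τ : ℂ) + n))) := by
    intro n
    rw [h0, h0]
    simp
    ring
  rw [tsum_congr h1, h, h0]
  simp only [map_sub, map_neg, map_mul, map_div₀, map_one, map_ofNat, Complex.conj_ofReal,
    Complex.conj_I, conj_powSum, Int.cast_zero, add_zero]
  ring

/-- The constant term of the expansion of the row sum with exponents `a` and `b`. -/
def rowConst (a b : ℕ) : ℚ :=
  if a = 0 ∨ b = 0 then 0 else (-1) ^ (b + 1) * ((a + b - 2).choose (a - 1) : ℚ)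

/-- Pascal's rule. It fails at `a = b = 0`, where the constant `1` of `tsum_rowTerm_one_one` enters.
-/
lemma rowConst_succ_succ {a b : ℕ} (h : 1 ≤ a + b) :
    rowConst (a + 1) (b + 1) = rowConst a (b + 1) - rowConst (a + 1) b := by
  rcases a with _ | a
  · rcases b with _ | b
    · omega
    · simp [rowConst, pow_succ]
  · rcases b with _ | b
    · simp [rowConst]
    · simp only [rowConst, Nat.add_eq_zero_iff, one_ne_zero, and_false, or_self, if_false]
      rw [show a + 1 + 1 + (b + 1 + 1) - 2 = a + b + 1 + 1 by omega,
        show a + 1 + (b + 1 + 1) - 2 = a + b + 1 by omega,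
        show a + 1 + 1 + (b + 1) - 2 = a + b + 1 by omega,
        show a + 1 + 1 - 1 = a + 1 by omega, show a + 1 - 1 = a by omega,
        Nat.choose_succ_succ (a + b + 1) a]
      push_cast
      ring

/-- The expansion of a row sum in the nome, its conjugate and `1 / (2 𝕃)`. -/
theorem exists_tsum_rowTerm_eq (N : ℕ) : ∀ a b : ℕ, a + b = N + 2 → ∃ α β : ℕ → ℚ, ∀ τ : ℍ,
    ∑' n, rowTerm a b τ n = (2 * Real.pi * Complex.I) ^ (N + 2) *
      ((rowConst a b : ℂ) * (2 * LL τ)⁻¹ ^ (N + 1) +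
        ∑ j ∈ Finset.range (N + 2), (2 * LL τ)⁻¹ ^ j *
          ((α j : ℂ) * powSum (N + 1 - j) (nome τ) +
            (β j : ℂ) * powSum (N + 1 - j) (conj (nome τ)))) := by
  induction N with
  | zero =>
    intro a b hab
    obtain ⟨rfl, rfl⟩ | ⟨rfl, rfl⟩ | ⟨rfl, rfl⟩ :
        (a = 0 ∧ b = 2) ∨ (a = 1 ∧ b = 1) ∨ (a = 2 ∧ b = 0) := by omega
    · refine ⟨0, Pi.single 0 1, fun τ => ?_⟩
      rw [tsum_rowTerm_zero_left 0]
      simp [rowConst, Finset.sum_range_succ]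
    · refine ⟨Pi.single 1 1, Pi.single 1 1, fun τ => ?_⟩
      rw [tsum_rowTerm_one_one]
      simp [rowConst, Finset.sum_range_succ]
      ring
    · refine ⟨Pi.single 0 1, 0, fun τ => ?_⟩
      rw [tsum_rowTerm_zero_right 0]
      simp [rowConst, Finset.sum_range_succ]
  | succ N ih =>
    intro a b hab
    rcases a with _ | a
    · obtain rfl : b = (N + 1) + 2 := by omega
      refine ⟨0, Pi.single 0 (1 / ((N + 2).factorial : ℚ)), fun τ => ?_⟩
      rw [tsum_rowTerm_zero_left (N + 1), Finset.sum_range_succ']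
      simp [rowConst]
    rcases b with _ | b
    · obtain rfl : a = N + 2 := by omega
      refine ⟨Pi.single 0 ((-1) ^ (N + 1) / ((N + 2).factorial : ℚ)), 0, fun τ => ?_⟩
      rw [tsum_rowTerm_zero_right (N + 1), Finset.sum_range_succ']
      simp [rowConst]
    obtain ⟨α₁, β₁, h₁⟩ := ih a (b + 1) (by omega)
    obtain ⟨α₂, β₂, h₂⟩ := ih (a + 1) b (by omega)
    -- The factor `(2 𝕃)⁻¹` from partial fractions shifts `j` by one.
    refine ⟨fun j => if j = 0 then 0 else α₁ (j - 1) - α₂ (j - 1),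
      fun j => if j = 0 then 0 else β₁ (j - 1) - β₂ (j - 1), fun τ => ?_⟩
    simp only [rowTerm_succ_succ]
    rw [tsum_mul_left, (summable_rowTerm (by omega) τ).tsum_sub (summable_rowTerm (by omega) τ),
      h₁, h₂, rowConst_succ_succ (by omega), Finset.sum_range_succ' _ (N + 2), ← mul_sub,
      add_sub_add_comm, ← Finset.sum_sub_distrib]
    simp only [Nat.add_sub_add_right, Nat.add_eq_zero_iff, one_ne_zero, and_false, if_false,
      if_true, Nat.add_sub_cancel, Rat.cast_sub, Rat.cast_zero, zero_mul, add_zero, mul_zero]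
    have h : ∀ j, (2 * LL τ)⁻¹ ^ (j + 1) *
        (((α₁ j : ℂ) - α₂ j) * powSum (N + 1 - j) (nome τ) +
          ((β₁ j : ℂ) - β₂ j) * powSum (N + 1 - j) (conj (nome τ))) =
        (2 * LL τ)⁻¹ * ((2 * LL τ)⁻¹ ^ j * ((α₁ j : ℂ) * powSum (N + 1 - j) (nome τ) +
          (β₁ j : ℂ) * powSum (N + 1 - j) (conj (nome τ))) -
        (2 * LL τ)⁻¹ ^ j * ((α₂ j : ℂ) * powSum (N + 1 - j) (nome τ) +
          (β₂ j : ℂ) * powSum (N + 1 - j) (conj (nome τ)))) := fun j => by ring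
    simp only [h, ← Finset.mul_sum]
    ring

/-! ### Operations on expansions with rational coefficients -/

/-- A common index set allows two expansions to be added or subtracted termwise. -/
lemma IsQExpansion.eq_sum {f : ℍ → ℂ} {a : ℤ →₀ (ℕ × ℕ → ℂ)} (h : IsQExpansion f a)
    {t : Finset ℤ} (ht : a.support ⊆ t) (z : ℍ) :
    f z = ∑ k ∈ t, LL z ^ k * ∑' p : ℕ × ℕ, a k p * nome z ^ p.1 * conj (nome z) ^ p.2 := by
  rw [(h z).2, Finsupp.sum_of_support_subset _ ht]
  simp

lemma IsQExpansion.add {f g : ℍ → ℂ} {a b : ℤ →₀ (ℕ × ℕ → ℂ)} (hf : IsQExpansion f a)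
    (hg : IsQExpansion g b) : IsQExpansion (fun z => f z + g z) (a + b) := by
  classical
  intro z
  refine ⟨fun k => ?_, ?_⟩
  · simpa [add_mul] using ((hf z).1 k).add ((hg z).1 k)
  · beta_reduce
    rw [Finsupp.sum_of_support_subset _ Finsupp.support_add _ (by simp),
      hf.eq_sum Finset.subset_union_left z, hg.eq_sum Finset.subset_union_right z,
      ← Finset.sum_add_distrib]
    refine Finset.sum_congr rfl fun k _ => ?_
    rw [← mul_add, ← ((hf z).1 k).tsum_add ((hg z).1 k)]
    simp [add_mul]

lemma isQExpansion_single (k : ℤ) {c : ℕ × ℕ → ℂ}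
    (hc : ∀ z : ℍ, Summable fun p : ℕ × ℕ => c p * nome z ^ p.1 * conj (nome z) ^ p.2) :
    IsQExpansion
      (fun z => LL z ^ k * ∑' p : ℕ × ℕ, c p * nome z ^ p.1 * conj (nome z) ^ p.2)
      (Finsupp.single k c) := by
  intro z
  refine ⟨fun k' => ?_, ?_⟩
  · rcases eq_or_ne k k' with rfl | h
    · simpa using hc z
    · simp [Finsupp.single_eq_of_ne' h]
  · rw [Finsupp.sum_single_index (by simp)]

lemma constantPart_add (a b : ℤ →₀ (ℕ × ℕ → ℂ)) :
    constantPart (a + b) = constantPart a + constantPart b :=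
  Finsupp.sum_add_index' (by simp) (by simp [add_mul])

/-- `f` has an expansion with constant part `P` whose other coefficients are rational. -/
def HasRatExpansion (f : ℍ → ℂ) (P : LaurentPolynomial ℂ) : Prop :=
  ∃ a : ℤ →₀ (ℕ × ℕ → ℂ), IsQExpansion f a ∧ constantPart a = P ∧
    ∀ (k : ℤ) (m n : ℕ), (m, n) ≠ (0, 0) → ∃ c : ℚ, a k (m, n) = (c : ℂ)

lemma HasRatExpansion.add {f g : ℍ → ℂ} {P Q : LaurentPolynomial ℂ} (hf : HasRatExpansion f P)
    (hg : HasRatExpansion g Q) : HasRatExpansion (fun z => f z + g z) (P + Q) := by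
  obtain ⟨a, ha, rfl, har⟩ := hf
  obtain ⟨b, hb, rfl, hbr⟩ := hg
  refine ⟨a + b, ha.add hb, constantPart_add a b, fun k m n hmn => ?_⟩
  obtain ⟨c, hc⟩ := har k m n hmn
  obtain ⟨d, hd⟩ := hbr k m n hmn
  exact ⟨c + d, by simp [hc, hd]⟩

lemma hasRatExpansion_zero : HasRatExpansion (fun _ => 0) 0 :=
  ⟨0, fun z => by simp, by simp [constantPart],
    fun k m n _ => ⟨0, by simp⟩⟩

lemma HasRatExpansion.sum {ι : Type*} (t : Finset ι) {f : ι → ℍ → ℂ}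
    (hf : ∀ i ∈ t, HasRatExpansion (f i) 0) :
    HasRatExpansion (fun z => ∑ i ∈ t, f i z) 0 := by
  classical
  induction t using Finset.induction_on with
  | empty => simpa using hasRatExpansion_zero
  | insert i t hi ih =>
    simp only [Finset.sum_insert hi]
    simpa using (hf i (by simp)).add (ih fun j hj => hf j (by simp [hj]))

lemma hasRatExpansion_single {k : ℤ} {c : ℕ × ℕ → ℂ}
    (hc : ∀ z : ℍ, Summable fun p : ℕ × ℕ => c p * nome z ^ p.1 * conj (nome z) ^ p.2)
    (hr : ∀ m n : ℕ, (m, n) ≠ (0, 0) → ∃ d : ℚ, c (m, n) = d) :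
    HasRatExpansion
      (fun z => LL z ^ k * ∑' p : ℕ × ℕ, c p * nome z ^ p.1 * conj (nome z) ^ p.2)
      (LaurentPolynomial.C (c (0, 0)) * LaurentPolynomial.T k) := by
  refine ⟨_, isQExpansion_single k hc, ?_, fun k' m n hmn => ?_⟩
  · rw [constantPart, Finsupp.sum_single_index (by simp)]
  · rcases eq_or_ne k k' with rfl | h
    · simpa using hr m n hmn
    · exact ⟨0, by simp [Finsupp.single_eq_of_ne' h]⟩

lemma hasRatExpansion_const (k : ℤ) (C : ℂ) :
    HasRatExpansion (fun z => C * LL z ^ k) (LaurentPolynomial.C C * LaurentPolynomial.T k) := by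
  have h0 : ∀ (z : ℍ) (p : ℕ × ℕ), p ≠ (0, 0) →
      (Pi.single (0, 0) C : ℕ × ℕ → ℂ) p * nome z ^ p.1 * conj (nome z) ^ p.2 = 0 :=
    fun z p hp => by simp [Pi.single_eq_of_ne hp]
  have h := hasRatExpansion_single (k := k) (c := Pi.single (0, 0) C)
    (fun z => (hasSum_single (0, 0) (h0 z)).summable)
    (fun m n hmn => ⟨0, by simp [Pi.single_eq_of_ne hmn]⟩)
  simp only [Pi.single_eq_same] at h
  convert h using 2 with z
  rw [tsum_eq_single (0, 0) (h0 z)]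
  simp [mul_comm]

lemma hasSum_extend_iff {ι κ : Type*} {i : ι → κ} (hi : Function.Injective i) {c : ι → ℂ}
    {g : κ → ℂ} {y : ℂ} :
    HasSum (fun p => Function.extend i c 0 p * g p) y ↔ HasSum (fun n => c n * g (i n)) y := by
  rw [← hi.hasSum_iff]
  · simp [Function.comp_def, hi.extend_apply]
  · intro p hp
    rw [Function.extend_apply' _ _ _ (by simpa using hp)]
    simp

/-- Treats series in `q` alone and in `q̄` alone together, with `i n = (n, 0)` or `(0, n)`. -/
lemma hasRatExpansion_of_injective (k : ℤ) {i : ℕ → ℕ × ℕ} (hi : Function.Injective i)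
    (hi0 : i 0 = (0, 0)) {c : ℕ → ℚ} (h0 : c 0 = 0)
    (hc : ∀ z : ℍ, Summable fun n => (c n : ℂ) * (nome z ^ (i n).1 * conj (nome z) ^ (i n).2)) :
    HasRatExpansion
      (fun z => LL z ^ k * ∑' n, (c n : ℂ) * (nome z ^ (i n).1 * conj (nome z) ^ (i n).2)) 0 := by
  have hs := fun z => (hasSum_extend_iff hi
    (g := fun p => nome z ^ p.1 * conj (nome z) ^ p.2)).2 (hc z).hasSum
  simp only [← mul_assoc] at hs
  have h := hasRatExpansion_single (k := k) (fun z => (hs z).summable) fun m n _ => by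
    by_cases hp : ∃ a, i a = (m, n)
    · obtain ⟨a, ha⟩ := hp
      exact ⟨c a, by rw [← ha, hi.extend_apply]⟩
    · exact ⟨0, by rw [Function.extend_apply' _ _ _ hp]; simp⟩
  rw [← hi0, hi.extend_apply, h0] at h
  simp only [(hs _).tsum_eq] at h
  simpa [mul_assoc] using h

lemma hasRatExpansion_nome (k : ℤ) {c : ℕ → ℚ} (h0 : c 0 = 0)
    (hc : ∀ x : ℂ, ‖x‖ < 1 → Summable fun n => (c n : ℂ) * x ^ n) :
    HasRatExpansion (fun z => LL z ^ k * ∑' n, (c n : ℂ) * nome z ^ n) 0 := by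
  simpa using hasRatExpansion_of_injective k (i := fun n => (n, 0))
    (fun m n h => by simpa using h) rfl h0 (fun z => by simpa using hc _ (norm_nome_lt_one z))

lemma hasRatExpansion_conj_nome (k : ℤ) {c : ℕ → ℚ} (h0 : c 0 = 0)
    (hc : ∀ x : ℂ, ‖x‖ < 1 → Summable fun n => (c n : ℂ) * x ^ n) :
    HasRatExpansion (fun z => LL z ^ k * ∑' n, (c n : ℂ) * conj (nome z) ^ n) 0 := by
  simpa using hasRatExpansion_of_injective k (i := fun n => (0, n))
    (fun m n h => by simpa using h) rfl h0
    (fun z => by simpa using hc _ (norm_conj_nome_lt_one z))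

/-! ### Lambert series -/

/-- The coefficients `∑_{m d = n} m ^ (-j) d ^ k` of a Lambert series. -/
def lambertCoeff (j k n : ℕ) : ℚ :=
  ∑ p ∈ n.divisorsAntidiagonal, ((p.1 : ℚ)⁻¹) ^ j * (p.2 : ℚ) ^ k

lemma lambertCoeff_zero (j k : ℕ) : lambertCoeff j k 0 = 0 := by simp [lambertCoeff]

/-- Both series regroup one absolutely convergent sum over pairs `(m, d)`: by `m`, and by the
product `n = m d`. -/
lemma hasSum_lambert (j k : ℕ) {x : ℂ} (hx : ‖x‖ < 1) :
    ∃ y, HasSum (fun m : ℕ+ => ((m : ℂ)⁻¹) ^ j * powSum k (x ^ (m : ℕ))) y ∧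
      HasSum (fun n : ℕ => (lambertCoeff j k n : ℂ) * x ^ n) y := by
  set F : ℕ+ × ℕ+ → ℂ := fun p => ((p.1 : ℂ)⁻¹) ^ j * ((p.2 : ℂ) ^ k * x ^ (p.1 * p.2 : ℕ))
    with hF
  have hs : Summable F := by
    -- Since `m ^ (-j) ≤ 1`, the case `j = 0` dominates.
    refine Summable.of_norm_bounded (summable_prod_mul_pow k hx).norm fun p => ?_
    rw [hF, norm_mul]
    refine mul_le_of_le_one_left (norm_nonneg _) ?_
    rw [norm_pow, norm_inv, Complex.norm_natCast]
    exact pow_le_one₀ (by positivity) (inv_le_one_of_one_le₀ (by exact_mod_cast p.1.2))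
  refine ⟨∑' p, F p, ?_, ?_⟩
  · refine (hs.hasSum.prod_fiberwise fun m => (hs.prod_factor m).hasSum).congr_fun fun m => ?_
    simp only [hF, tsum_mul_left, powSum, pow_mul]
  · have h := (sigmaAntidiagonalEquivProd.hasSum_iff.2 hs.hasSum).sigma
      fun n => hasSum_fintype _
    have h' := (hasSum_pnat_iff (f := fun n : ℕ => (lambertCoeff j k n : ℂ) * x ^ n)
      (a := ∑' p, F p)).1 (h.congr_fun fun n => ?_)
    · simpa [lambertCoeff_zero] using h'
    · simp only [Finset.univ_eq_attach, hF, Function.comp_def, sigmaAntidiagonalEquivProd,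
        divisorsAntidiagonalFactors, Equiv.coe_fn_mk, PNat.mk_coe]
      rw [(n : ℕ).divisorsAntidiagonal.sum_attach
        fun p : ℕ × ℕ => ((p.1 : ℂ)⁻¹) ^ j * ((p.2 : ℂ) ^ k * x ^ (p.1 * p.2)), lambertCoeff]
      push_cast
      rw [Finset.sum_mul]
      refine Finset.sum_congr rfl fun p hp => ?_
      rw [(Nat.mem_divisorsAntidiagonal.1 hp).1, mul_assoc]

/-! ### From the lattice sum to row sums -/

lemma norm_eisTerm (r s : ℕ) (z : ℍ) (p : ℤ × ℤ) :
    ‖eisTerm r s z p‖ = ‖LL z‖ * ‖(p.1 : ℂ) * (z : ℂ) + p.2‖ ^ (-((r + s + 2 : ℕ) : ℝ)) := by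
  have h : (p.1 : ℂ) * conj (z : ℂ) + p.2 = conj ((p.1 : ℂ) * (z : ℂ) + p.2) := by simp
  rw [eisTerm, h, norm_div, norm_mul, norm_pow, norm_pow, Complex.norm_conj, ← pow_add,
    Real.rpow_neg (norm_nonneg _), Real.rpow_natCast, div_eq_mul_inv]
  congr 3
  omega

/-- In absolute value only the total exponent `r + s + 2 > 2` matters, as for holomorphic Eisenstein
series. -/
theorem summable_eisTerm {r s : ℕ} (h : 0 < r + s) (z : ℍ) : Summable (eisTerm r s z) := by
  have h2 : (2 : ℝ) < ((r + s + 2 : ℕ) : ℝ) := by exact_mod_cast (by omega)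
  have h1 := ((EisensteinSeries.summable_one_div_norm_rpow h2).mul_left
    (‖LL z‖ * EisensteinSeries.r z ^ (-((r + s + 2 : ℕ) : ℝ))))
  rw [← (finTwoArrowEquiv ℤ).symm.summable_iff] at h1
  refine Summable.of_norm_bounded h1 fun p => ?_
  rw [norm_eisTerm, Function.comp_apply, mul_assoc]
  exact mul_le_mul_of_nonneg_left
    (EisensteinSeries.summand_bound z (by positivity) ((finTwoArrowEquiv ℤ).symm p))
    (norm_nonneg _)

/-- The point `m z` of the upper half-plane. -/
def natScale (m : ℕ+) (z : ℍ) : ℍ :=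
  ⟨(m : ℂ) * z, by simpa using mul_pos (Nat.cast_pos.2 m.pos) z.im_pos⟩

lemma LL_natScale (m : ℕ+) (z : ℍ) : LL (natScale m z) = m * LL z := by
  have h : (natScale m z).im = m * z.im := by
    rw [← coe_im, ← coe_im]
    simp [natScale]
  rw [LL, LL, h]
  push_cast
  ring

lemma nome_natScale (m : ℕ+) (z : ℍ) : nome (natScale m z) = nome z ^ (m : ℕ) := by
  rw [nome, nome, ← Complex.exp_nat_mul]
  congr 1
  simp only [natScale]
  ring

lemma eisTerm_pnat (r s : ℕ) (z : ℍ) (m : ℕ+) (n : ℤ) :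
    eisTerm r s z ((m : ℕ), n) = LL z * rowTerm (r + 1) (s + 1) (natScale m z) n := by
  simp [eisTerm, rowTerm, natScale, div_eq_mul_inv]

lemma eisTerm_neg {r s : ℕ} (h : Even (r + s)) (z : ℍ) (m n : ℤ) :
    eisTerm r s z (-m, -n) = eisTerm r s z (m, n) := by
  have h1 : (-1 : ℂ) ^ (r + 1) * (-1) ^ (s + 1) = 1 := by
    rw [← pow_add, show r + 1 + (s + 1) = r + s + 2 by ring]
    exact (h.add even_two).neg_one_pow
  simp only [eisTerm]
  push_cast
  rw [show -(m : ℂ) * z + -n = (-1) * (m * z + n) by ring,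
    show -(m : ℂ) * conj (z : ℂ) + -n = (-1) * (m * conj (z : ℂ) + n) by ring, mul_pow, mul_pow,
    mul_mul_mul_comm, h1, one_mul]

lemma tsum_eisTerm_zero {r s : ℕ} (h : Even (r + s)) (z : ℍ) :
    ∑' n : ℤ, eisTerm r s z (0, n) = LL z * (2 * riemannZeta ((r + s + 2 : ℕ) : ℂ)) := by
  rw [two_mul_riemannZeta_eq_tsum_int_inv_pow_of_even (by omega) (h.add even_two),
    ← tsum_mul_left]
  refine tsum_congr fun n => ?_
  rw [eisTerm, show r + s + 2 = r + 1 + (s + 1) by ring]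
  simp [div_eq_mul_inv, pow_add]

lemma tsum_eisTerm {r s : ℕ} (h : Even (r + s)) (h0 : 0 < r + s) (z : ℍ) :
    ∑' p : {p : ℤ × ℤ // p ≠ (0, 0)}, eisTerm r s z p =
      LL z * (2 * riemannZeta ((r + s + 2 : ℕ) : ℂ)) +
        2 * (LL z * ∑' m : ℕ+, ∑' n, rowTerm (r + 1) (s + 1) (natScale m z) n) := by
  have hs := summable_eisTerm h0 z
  -- At the origin the term is a division by zero, with value `0`, so the origin may be included in
  -- the sum.
  have hsub : Function.support (eisTerm r s z) ⊆ {p | p ≠ (0, 0)} := by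
    intro p hp h0
    apply hp
    simp [h0, eisTerm]
  have htot : ∑' p : {p : ℤ × ℤ // p ≠ (0, 0)}, eisTerm r s z p = ∑' p, eisTerm r s z p :=
    tsum_subtype_eq_of_support_subset hsub
  rw [htot, hs.tsum_prod,
    tsum_int_eq_zero_add_two_mul_tsum_pnat (fun m => ?_) hs.prod, tsum_eisTerm_zero h]
  · rw [two_nsmul, ← two_mul]
    simp only [eisTerm_pnat, tsum_mul_left]
  · rw [← (Equiv.neg ℤ).tsum_eq]
    exact tsum_congr fun n => eisTerm_neg h z m n

lemma hasSum_pnat_inv_pow {k : ℕ} (hk : 1 < k) :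
    HasSum (fun m : ℕ+ => ((m : ℂ)⁻¹) ^ k) (riemannZeta k) := by
  have hs : Summable fun m : ℕ => ((m : ℂ)⁻¹) ^ k := by
    simpa using (Complex.summable_one_div_nat_cpow (p := k)).2 (by simpa using hk)
  have h := (hasSum_pnat_iff (f := fun m : ℕ => ((m : ℂ)⁻¹) ^ k) (a := riemannZeta k)).2
  simp only [Nat.cast_zero, inv_zero, zero_pow (show k ≠ 0 by omega), add_zero] at h
  apply h
  rw [zeta_nat_eq_tsum_of_gt_one hk]
  simpa only [one_div, inv_pow] using hs.hasSum

/-- The sum `∑ lambertCoeff j k n x ^ n` of a Lambert series. -/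
noncomputable def lambertSum (j k : ℕ) (x : ℂ) : ℂ := ∑' n, (lambertCoeff j k n : ℂ) * x ^ n

lemma hasSum_lambertSum (j k : ℕ) {x : ℂ} (hx : ‖x‖ < 1) :
    HasSum (fun m : ℕ+ => ((m : ℂ)⁻¹) ^ j * powSum k (x ^ (m : ℕ))) (lambertSum j k x) := by
  obtain ⟨y, h1, h2⟩ := hasSum_lambert j k hx
  rwa [lambertSum, h2.tsum_eq]

/-- Passing from `z` to `m z` multiplies `(2 𝕃)⁻¹` by `m⁻¹` and replaces `q` by `q ^ m`; hence `ζ(w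
+ 1)` from the constant terms and Lambert sums from the others. -/
lemma exists_tsum_eisTerm_eq {r s : ℕ} (h : Even (r + s)) (h0 : 0 < r + s) :
    ∃ α β : ℕ → ℚ, ∀ z : ℍ, ∑' p : {p : ℤ × ℤ // p ≠ (0, 0)}, eisTerm r s z p =
      LL z * (2 * riemannZeta ((r + s + 2 : ℕ) : ℂ)) +
        2 * (LL z * ((2 * Real.pi * Complex.I) ^ (r + s + 2) *
          ((rowConst (r + 1) (s + 1) : ℂ) * (2 * LL z)⁻¹ ^ (r + s + 1) *
            riemannZeta ((r + s + 1 : ℕ) : ℂ) +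
          ∑ j ∈ Finset.range (r + s + 2), (2 * LL z)⁻¹ ^ j *
            ((α j : ℂ) * lambertSum j (r + s + 1 - j) (nome z) +
              (β j : ℂ) * lambertSum j (r + s + 1 - j) (conj (nome z)))))) := by
  obtain ⟨α, β, hαβ⟩ := exists_tsum_rowTerm_eq (r + s) (r + 1) (s + 1) (by ring)
  refine ⟨α, β, fun z => ?_⟩
  rw [tsum_eisTerm h h0 z]
  congr 3
  refine HasSum.tsum_eq ?_
  have h1 := (hasSum_pnat_inv_pow (k := r + s + 1) (by omega)).mul_left
    ((rowConst (r + 1) (s + 1) : ℂ) * (2 * LL z)⁻¹ ^ (r + s + 1))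
  have h2 := hasSum_sum (s := Finset.range (r + s + 2)) fun j _ =>
    (((hasSum_lambertSum j (r + s + 1 - j) (norm_nome_lt_one z)).mul_left (α j : ℂ)).add
      ((hasSum_lambertSum j (r + s + 1 - j) (norm_conj_nome_lt_one z)).mul_left
        (β j : ℂ))).mul_left ((2 * LL z)⁻¹ ^ j)
  refine ((h1.add h2).mul_left ((2 * Real.pi * Complex.I : ℂ) ^ (r + s + 2))).congr_fun
    fun m => ?_
  rw [hαβ, LL_natScale, nome_natScale, map_pow, show (2 * ((m : ℂ) * LL z))⁻¹ =
    (2 * LL z)⁻¹ * (m : ℂ)⁻¹ by rw [← mul_inv]; ring_nf]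
  simp only [mul_pow]
  congr 2
  · ring
  · exact Finset.sum_congr rfl fun j _ => by ring

/-- Euler's formula for `ζ` at positive even integers. -/
lemma zeta_even_term {w : ℕ} (hev : Even w) :
    (w.factorial : ℂ) / (2 * Real.pi * Complex.I) ^ (w + 2) * riemannZeta ((w + 2 : ℕ) : ℂ) =
      -(bernoulli (w + 2) : ℂ) / (2 * ((w : ℂ) + 1) * ((w : ℂ) + 2)) := by
  obtain ⟨k, rfl⟩ := hev
  have h := riemannZeta_two_mul_nat (k := k + 1) (by omega)
  rw [show ((k + k + 2 : ℕ) : ℂ) = 2 * ((k + 1 : ℕ) : ℂ) by push_cast; ring, h]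
  rw [show k + k + 2 = 2 * (k + 1) by ring, mul_pow, mul_pow, pow_mul Complex.I, Complex.I_sq,
    show 2 * (k + 1) - 1 = 2 * k + 1 by omega, show k + k = 2 * k by ring,
    show (2 * (k + 1)).factorial = (2 * k + 2) * ((2 * k + 1) * (2 * k).factorial) by
      rw [show 2 * (k + 1) = 2 * k + 1 + 1 by ring, Nat.factorial_succ, Nat.factorial_succ]]
  have h1 : ((2 * k).factorial : ℂ) ≠ 0 := by exact_mod_cast Nat.factorial_ne_zero _
  have h2 : (2 * (k : ℂ) + 1) ≠ 0 := by exact_mod_cast Nat.succ_ne_zero (2 * k)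
  have h3 : (2 * (k : ℂ) + 2) ≠ 0 := by exact_mod_cast Nat.succ_ne_zero (2 * k + 1)
  have h4 : (Real.pi : ℂ) ≠ 0 := by exact_mod_cast Real.pi_ne_zero
  have h5 : ((-1 : ℂ) ^ k) * (-1) ^ k = 1 := by rw [← mul_pow]; simp
  have h6 : ((-1 : ℂ) ^ k) ≠ 0 := by simp
  push_cast
  field_simp
  ring

/-! ### Existence of the expansion -/

lemma HasRatExpansion.congr {f g : ℍ → ℂ} {P : LaurentPolynomial ℂ} (hf : HasRatExpansion f P)
    (hfg : ∀ z, g z = f z) : HasRatExpansion g P :=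
  (funext hfg : g = f) ▸ hf

lemma summable_const_mul_lambertCoeff (c : ℚ) (j k : ℕ) {x : ℂ} (hx : ‖x‖ < 1) :
    Summable fun n => ((c * lambertCoeff j k n : ℚ) : ℂ) * x ^ n := by
  obtain ⟨y, -, h⟩ := hasSum_lambert j k hx
  simpa [mul_assoc] using h.summable.mul_left (c : ℂ)

lemma tsum_const_mul_lambertCoeff (c : ℚ) (j k : ℕ) (x : ℂ) :
    ∑' n, ((c * lambertCoeff j k n : ℚ) : ℂ) * x ^ n = c * lambertSum j k x := by
  rw [lambertSum, ← tsum_mul_left]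
  exact tsum_congr fun n => by push_cast; ring

lemma hasRatExpansion_lambert (l : ℤ) (c d : ℚ) (j k : ℕ) :
    HasRatExpansion (fun z => LL z ^ l * (c * lambertSum j k (nome z)) +
      LL z ^ l * (d * lambertSum j k (conj (nome z)))) 0 := by
  have h := (hasRatExpansion_nome l (c := fun n => c * lambertCoeff j k n)
    (by simp [lambertCoeff_zero]) fun x hx => summable_const_mul_lambertCoeff c j k hx).add
    (hasRatExpansion_conj_nome l (c := fun n => d * lambertCoeff j k n)
    (by simp [lambertCoeff_zero]) fun x hx => summable_const_mul_lambertCoeff d j k hx)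
  simpa only [tsum_const_mul_lambertCoeff, add_zero] using h

lemma hasRatExpansion_realEis {r s w : ℕ} (hrs : w = r + s) (hw : 0 < w) (hev : Even w) :
    HasRatExpansion (realEis r s)
      (LaurentPolynomial.C
            (-(bernoulli (w + 2) : ℂ) / (2 * ((w : ℂ) + 1) * ((w : ℂ) + 2))) *
          LaurentPolynomial.T 1 +
        LaurentPolynomial.C
            ((-1 : ℂ) ^ s / 2 * ((w.factorial : ℂ) / 2 ^ w) * (w.choose r : ℂ) *
              riemannZeta ((w : ℂ) + 1)) *
          LaurentPolynomial.T (-(w : ℤ))) := by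
  subst hrs
  obtain ⟨α, β, hαβ⟩ := exists_tsum_eisTerm_eq hev hw
  -- The `1 / 2` in `realEis` cancels the doubling of rows, and `𝕃 (2 𝕃) ^ (-j) = 2 ^ (-j) 𝕃 ^ (1 -
  -- j)`; this accounts for the coefficients `w! / 2 ^ j`. The constants `C` and `D` are fixed by
  -- the goal.
  have hall := fun C D : ℂ =>
    ((hasRatExpansion_const 1 C).add (hasRatExpansion_const (-((r + s : ℕ) : ℤ)) D)).add
    (HasRatExpansion.sum (Finset.range (r + s + 2)) fun j _ =>
      hasRatExpansion_lambert (1 - j : ℤ) ((r + s).factorial / 2 ^ j * α j)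
        ((r + s).factorial / 2 ^ j * β j) j (r + s + 1 - j))
  simp only [add_zero] at hall
  refine (hall _ _).congr fun z => ?_
  have hL := LL_ne_zero z
  have hpi : (2 * Real.pi * Complex.I : ℂ) ^ (r + s + 2) ≠ 0 := by
    simp [Real.pi_ne_zero]
  have hfin : (∑ j ∈ Finset.range (r + s + 2),
      (LL z ^ (1 - j : ℤ) * ((((r + s).factorial / 2 ^ j * α j : ℚ) : ℂ) *
          lambertSum j (r + s + 1 - j) (nome z)) +
        LL z ^ (1 - j : ℤ) * ((((r + s).factorial / 2 ^ j * β j : ℚ) : ℂ) *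
          lambertSum j (r + s + 1 - j) (conj (nome z))))) =
      ((r + s).factorial : ℂ) * LL z * ∑ j ∈ Finset.range (r + s + 2), (2 * LL z)⁻¹ ^ j *
            ((α j : ℂ) * lambertSum j (r + s + 1 - j) (nome z) +
              (β j : ℂ) * lambertSum j (r + s + 1 - j) (conj (nome z))) := by
    rw [Finset.mul_sum]
    refine Finset.sum_congr rfl fun j _ => ?_
    have hz : LL z ^ (1 - j : ℤ) = LL z * (LL z)⁻¹ ^ j := by
      rw [zpow_sub₀ hL, zpow_one, zpow_natCast, inv_pow, div_eq_mul_inv]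
    rw [hz]
    push_cast
    simp only [mul_inv, mul_pow, inv_pow]
    ring
  rw [hfin, realEis, hαβ z, ← zeta_even_term hev]
  have hrow : (rowConst (r + 1) (s + 1) : ℂ) = (-1) ^ s * ((r + s).choose r : ℂ) := by
    simp [rowConst, pow_succ, show r + 1 + (s + 1) - 2 = r + s by omega]
  have hzp : LL z ^ (-((r + s : ℕ) : ℤ)) = (LL z)⁻¹ ^ (r + s) := by
    rw [zpow_neg, zpow_natCast, inv_pow]
  have hu : LL z * (2 * LL z)⁻¹ ^ (r + s + 1) = (2 ^ (r + s) * 2 : ℂ)⁻¹ * (LL z)⁻¹ ^ (r + s) := by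
    rw [mul_inv, mul_pow, pow_succ (LL z)⁻¹, ← pow_succ (2 : ℂ), inv_pow]
    field_simp
  rw [hrow, hzp, zpow_one, show ((r + s : ℕ) : ℂ) + 1 = ((r + s + 1 : ℕ) : ℂ) by push_cast; ring]
  generalize (∑ j ∈ Finset.range (r + s + 2), (2 * LL z)⁻¹ ^ j *
            ((α j : ℂ) * lambertSum j (r + s + 1 - j) (nome z) +
              (β j : ℂ) * lambertSum j (r + s + 1 - j) (conj (nome z)))) = X
  generalize (2 * Real.pi * Complex.I : ℂ) ^ (r + s + 2) = Y at *
  generalize riemannZeta ((r + s + 2 : ℕ) : ℂ) = Z2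
  generalize riemannZeta ((r + s + 1 : ℕ) : ℂ) = Z1
  have hcan : ((r + s).factorial : ℂ) / Y * Y = (r + s).factorial := div_mul_cancel₀ _ hpi
  linear_combination ((-1) ^ s * ((r + s).choose r : ℂ) * Z1 * (LL z * (2 * LL z)⁻¹ ^ (r + s + 1))
    + LL z * X) * hcan + (-1) ^ s * ((r + s).choose r : ℂ) * Z1 * ((r + s).factorial : ℂ) * hu

/-! ### Uniqueness of the expansion -/

open Filter Topology Asymptotics in
/-- If a Laurent polynomial in `-y`, with coefficients that converge exponentially fast as
`y → ∞`, vanishes identically, then the limits of its coefficients vanish. -/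
theorem coeff_limit_eq_zero {t : Finset ℤ} {F : ℤ → ℝ → ℂ} {g : ℤ → ℂ}
    (hF : ∀ k ∈ t, (fun y => F k y - g k) =O[atTop] fun y : ℝ => Real.exp (-y))
    (h : ∀ᶠ y : ℝ in atTop, ∑ k ∈ t, (-(y : ℂ)) ^ k * F k y = 0) :
    ∀ k ∈ t, g k = 0 := by
  classical
  by_contra! hne
  obtain ⟨k₀, hk₀, hg₀⟩ := hne
  have hT : (t.filter fun k => g k ≠ 0).Nonempty := ⟨k₀, by simp [hk₀, hg₀]⟩
  -- Let `K` be the largest exponent with nonzero limit and divide by `(-y) ^ K`. Terms with `k < K`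
  -- decay like a negative power of `y`; those with `k > K` have `g k = 0` and decay exponentially
  -- up to a power of `y`. Only `g K` survives.
  obtain ⟨K, hK, hmax⟩ := (t.filter fun k => g k ≠ 0).exists_max_image id hT
  obtain ⟨hKt, hgK⟩ := Finset.mem_filter.1 hK
  have hlim : ∀ k ∈ t, Tendsto (fun y : ℝ => (-(y : ℂ)) ^ (k - K) * F k y) atTop
      (𝓝 (if k = K then g k else 0)) := by
    intro k hk
    have hFlim : Tendsto (F k) atTop (𝓝 (g k)) := by
      have h0 := ((hF k hk).trans_tendsto Real.tendsto_exp_neg_atTop_nhds_zero).add_const (g k)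
      simpa using h0
    rcases lt_trichotomy k K with hlt | rfl | hgt
    · rw [if_neg hlt.ne]
      obtain ⟨n, hn⟩ : ∃ n : ℕ, k - K = -((n + 1 : ℕ) : ℤ) := ⟨(K - k - 1).toNat, by omega⟩
      have hinv : Tendsto (fun y : ℝ => (-(y : ℂ)) ^ (k - K)) atTop (𝓝 0) := by
        rw [hn]
        simp only [zpow_neg, zpow_natCast]
        rw [tendsto_zero_iff_norm_tendsto_zero]
        simp only [norm_inv, norm_pow, norm_neg, Complex.norm_real]
        exact ((tendsto_pow_atTop (Nat.succ_ne_zero n)).comp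
          tendsto_norm_atTop_atTop).inv_tendsto_atTop
      simpa using hinv.mul hFlim
    · simpa using hFlim
    · rw [if_neg hgt.ne']
      have hgk : g k = 0 := by
        by_contra hgk
        exact absurd (hmax k (by simp [hk, hgk])) (by simpa using hgt)
      obtain ⟨n, hn⟩ : ∃ n : ℕ, k - K = n := ⟨(k - K).toNat, by omega⟩
      have hpow : (fun y : ℝ => (-(y : ℂ)) ^ n) =O[atTop] fun y : ℝ => y ^ n :=
        IsBigO.of_bound 1 (Eventually.of_forall fun y => by simp)
      have hO := hpow.mul (hF k hk)
      simp only [hgk, sub_zero] at hO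
      rw [hn]
      simp only [zpow_natCast]
      exact hO.trans_tendsto (Real.tendsto_pow_mul_exp_neg_atTop_nhds_zero n)
  have hsum := tendsto_finsetSum t hlim
  rw [Finset.sum_ite_eq' t K, if_pos hKt] at hsum
  refine hgK (tendsto_nhds_unique (hsum.congr' ?_) tendsto_const_nhds)
  filter_upwards [h, eventually_ne_atTop 0] with y hy hy0
  have hy0' : -(y : ℂ) ≠ 0 := by simpa using hy0
  rw [← mul_zero ((-(y : ℂ)) ^ (-K)), ← hy, Finset.mul_sum]
  refine Finset.sum_congr rfl fun k _ => ?_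
  rw [← mul_assoc, ← zpow_add₀ hy0', neg_add_eq_sub]

open Filter Asymptotics in
lemma tsum_sub_coeff_isBigO {c : ℕ → ℂ} (hc : ∀ x : ℂ, ‖x‖ < 1 → Summable fun n => c n * x ^ n) :
    (fun y : ℝ => ∑' n, c n * (Real.exp (-y) : ℂ) ^ n - c 0) =O[atTop]
      fun y : ℝ => Real.exp (-y) := by
  have hhalf : Summable fun n => ‖c (n + 1)‖ * (1 / 2) ^ n := by
    have h1 := (summable_nat_add_iff 1).2 (hc (1 / 2) (by norm_num)).norm
    refine (h1.mul_left 2).congr fun n => ?_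
    simp [pow_succ]
    ring
  refine IsBigO.of_bound (∑' n, ‖c (n + 1)‖ * (1 / 2) ^ n) ?_
  filter_upwards [eventually_ge_atTop (Real.log 2)] with y hy
  have hx : Real.exp (-y) ≤ 1 / 2 := by
    rw [Real.exp_neg, one_div]
    exact inv_anti₀ (by norm_num) ((Real.log_le_iff_le_exp (by norm_num)).1 hy)
  have hpos := (Real.exp_pos (-y)).le
  set x := Real.exp (-y)
  have hnx : ‖(x : ℂ)‖ < 1 := by
    rw [Complex.norm_real, Real.norm_of_nonneg hpos]
    linarith
  have hb : ∀ n, ‖c (n + 1) * (x : ℂ) ^ n‖ ≤ ‖c (n + 1)‖ * (1 / 2) ^ n := fun n => by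
    rw [norm_mul, norm_pow, Complex.norm_real, Real.norm_of_nonneg hpos]
    gcongr
  rw [(hc x hnx).tsum_eq_zero_add, pow_zero, mul_one, add_sub_cancel_left,
    Real.norm_of_nonneg hpos]
  simp only [pow_succ, ← mul_assoc]
  rw [tsum_mul_right, norm_mul, Complex.norm_real, Real.norm_of_nonneg hpos]
  gcongr
  exact tsum_of_norm_bounded hhalf.hasSum hb

/-- The powers of a logarithm are linearly independent over convergent power series. -/
theorem coeff_eq_zero_of_sum_log_pow {t : Finset ℤ} {c : ℤ → ℕ → ℂ}
    (hc : ∀ k, ∀ x : ℂ, ‖x‖ < 1 → Summable fun n => c k n * x ^ n)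
    (h : ∀ y : ℝ, 0 < y →
      ∑ k ∈ t, (-(y : ℂ)) ^ k * ∑' n, c k n * (Real.exp (-y) : ℂ) ^ n = 0) (n : ℕ) :
    ∀ k ∈ t, c k n = 0 := by
  induction n using Nat.strong_induction_on with
  | _ D ih =>
    have hsum : ∀ k, ∀ x : ℂ, ‖x‖ < 1 → Summable fun n => c k (n + D) * x ^ n := by
      intro k x hx
      rcases eq_or_ne x 0 with rfl | hx0
      · exact summable_of_ne_finset_zero (s := {0}) fun n hn => by
          rw [zero_pow (by simpa using hn), mul_zero]
      · refine (((summable_nat_add_iff D).2 (hc k x hx)).mul_right (x ^ D)⁻¹).congr fun n => ?_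
        rw [pow_add]
        field_simp
    have key := coeff_limit_eq_zero (t := t)
      (F := fun k y => ∑' n, c k (n + D) * (Real.exp (-y) : ℂ) ^ n) (g := fun k => c k D)
      (fun k _ => by
        simpa using tsum_sub_coeff_isBigO (c := fun n => c k (n + D)) (hsum k)) ?_
    · exact key
    filter_upwards [Filter.eventually_gt_atTop 0] with y hy
    have hx0 : (Real.exp (-y) : ℂ) ≠ 0 := by exact_mod_cast (Real.exp_pos _).ne'
    have hnx : ‖(Real.exp (-y) : ℂ)‖ < 1 := by
      rw [Complex.norm_real, Real.norm_of_nonneg (Real.exp_pos _).le]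
      simpa using hy
    have hy0 := h y hy
    -- Once all coefficients below `D` vanish, `e ^ (-D y)` factors out and degree `D` becomes the
    -- constant term.
    have hsplit : ∀ k ∈ t, (-(y : ℂ)) ^ k * ∑' n, c k n * (Real.exp (-y) : ℂ) ^ n =
        (Real.exp (-y) : ℂ) ^ D *
          ((-(y : ℂ)) ^ k * ∑' n, c k (n + D) * (Real.exp (-y) : ℂ) ^ n) := by
      intro k hk
      rw [← (hc k _ hnx).sum_add_tsum_nat_add D, Finset.sum_eq_zero fun i hi => by
        rw [ih i (Finset.mem_range.1 hi) k hk, zero_mul], zero_add]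
      simp only [pow_add, ← mul_assoc]
      rw [tsum_mul_right]
      ring
    rw [Finset.sum_congr rfl hsplit, ← Finset.mul_sum] at hy0
    exact (mul_eq_zero.1 hy0).resolve_left (pow_ne_zero _ hx0)

lemma infinite_sphere_complex : (Metric.sphere (0 : ℂ) 1).Infinite := by
  have h := isPreconnected_sphere (E := ℂ) (by rw [Complex.rank_real_complex]; norm_num) 0 1
  exact h.infinite_of_nontrivial ⟨1, by simp, -1, by simp, by norm_num⟩

/-- A homogeneous polynomial in `u` and `ū` that vanishes on the unit circle is zero. -/
theorem coeff_eq_zero_of_circle {d : ℕ × ℕ → ℂ} {N : ℕ}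
    (h : ∀ x : ℝ, ∑ p ∈ Finset.HasAntidiagonal.antidiagonal N,
      d p * (Complex.exp (x * Complex.I) ^ p.1 * conj (Complex.exp (x * Complex.I)) ^ p.2) = 0) :
    ∀ p ∈ Finset.HasAntidiagonal.antidiagonal N, d p = 0 := by
  set P : Polynomial ℂ :=
      ∑ p ∈ Finset.HasAntidiagonal.antidiagonal N, Polynomial.C (d p) * Polynomial.X ^ p.1
    with hP
  have hP0 : P = 0 := by
    refine Polynomial.eq_zero_of_infinite_isRoot _ (infinite_sphere_complex.mono fun w hw => ?_)
    have hw1 : ‖w‖ = 1 := by simpa using hw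
    -- On the circle `u ^ m ū ^ n u ^ N = (u ^ 2) ^ m` when `m + n = N`, so the hypothesis reads `P
    -- (u ^ 2) = 0`; half the argument supplies a square root `u` of `w`.
    have hexp : w = Complex.exp (((w.arg / 2 : ℝ) : ℂ) * Complex.I) ^ 2 := by
      rw [← Complex.exp_nat_mul]
      conv_lhs => rw [← Complex.norm_mul_exp_arg_mul_I w, hw1]
      push_cast
      rw [one_mul]
      ring_nf
    have hx := h (w.arg / 2)
    set u := Complex.exp (((w.arg / 2 : ℝ) : ℂ) * Complex.I) with hu
    have hu1 : conj u * u = 1 := by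
      rw [mul_comm, Complex.mul_conj, Complex.normSq_eq_norm_sq, hu, Complex.norm_exp_ofReal_mul_I]
      simp
    have hx' := congrArg (· * u ^ N) hx
    simp only [zero_mul, Finset.sum_mul] at hx'
    simp only [Set.mem_ofPred_eq, Polynomial.IsRoot, hP, Polynomial.eval_finsetSum,
      Polynomial.eval_mul, Polynomial.eval_C, Polynomial.eval_pow, Polynomial.eval_X]
    rw [← hx']
    refine Finset.sum_congr rfl fun p hp => ?_
    rw [hexp, ← Finset.HasAntidiagonal.mem_antidiagonal.1 hp]
    have hpow : (conj u) ^ p.2 * u ^ p.2 = 1 := by rw [← mul_pow, hu1, one_pow]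
    linear_combination (-(d p * u ^ p.1 * u ^ p.1)) * hpow
  intro p hp
  have hc := congrArg (fun Q => Polynomial.coeff Q p.1) hP0
  simp only [hP, Polynomial.finsetSum_coeff, Polynomial.coeff_C_mul_X_pow,
    Polynomial.coeff_zero] at hc
  rw [Finset.sum_eq_single p] at hc
  · simpa using hc
  · intro q hq hqp
    rw [if_neg]
    intro hpq
    apply hqp
    have h1 := Finset.HasAntidiagonal.mem_antidiagonal.1 hp
    have h2 := Finset.HasAntidiagonal.mem_antidiagonal.1 hq
    ext <;> omega
  · exact fun hn => absurd hp hn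

/-- Makes the phase of `q` and the value of `𝕃` independent parameters. -/
lemma exists_LL_nome (x : ℝ) {y : ℝ} (hy : 0 < y) :
    ∃ z : ℍ, LL z = -(y : ℂ) ∧
      nome z = Complex.exp (x * Complex.I) * (Real.exp (-y) : ℂ) := by
  have hpi := Real.pi_pos
  refine ⟨⟨⟨x / (2 * Real.pi), y / (2 * Real.pi)⟩, by simp; positivity⟩, ?_, ?_⟩
  · rw [LL, ← coe_im, ← Complex.ofReal_neg]
    congr 1
    simp only
    field_simp
  · rw [nome, Complex.ofReal_exp, ← Complex.exp_add]
    congr 1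
    apply Complex.ext <;> simp <;> field_simp

/-- Absolute convergence sees only moduli, so it passes from conjugate pairs `(q, q̄)` to pairs such
as `(u w, ū w)` with `w` complex. The pair `(0, 0)` is separate because `q` is never `0`. -/
lemma summable_of_summable_norm_lt {d : ℕ × ℕ → ℂ}
    (hd : ∀ z : ℍ, Summable fun p : ℕ × ℕ => d p * nome z ^ p.1 * conj (nome z) ^ p.2)
    {x y : ℂ} (h : ‖x‖ = ‖y‖) (hx : ‖x‖ < 1) :
    Summable fun p : ℕ × ℕ => d p * (x ^ p.1 * y ^ p.2) := by
  rcases eq_or_ne x 0 with rfl | hx0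
  · obtain rfl : y = 0 := by simpa using h.symm
    refine summable_of_ne_finset_zero (s := {(0, 0)}) fun p hp => ?_
    have : p.1 ≠ 0 ∨ p.2 ≠ 0 := by
      by_contra! hp'
      exact hp (by simp [Prod.ext_iff, hp'])
    rcases this with h | h <;> simp [zero_pow h]
  · have hpos : 0 < ‖x‖ := norm_pos_iff.2 hx0
    obtain ⟨z, -, hz⟩ := exists_LL_nome 0 (y := -Real.log ‖x‖)
      (by simpa using Real.log_neg hpos hx)
    have hn : nome z = (‖x‖ : ℂ) := by
      rw [hz]; simp only [neg_neg, Real.exp_log hpos]; simp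
    refine Summable.of_norm_bounded (hd z).norm fun p => ?_
    simp [hn, ← h, mul_assoc]

theorem IsQExpansion.unique {f : ℍ → ℂ} {a b : ℤ →₀ (ℕ × ℕ → ℂ)} (ha : IsQExpansion f a)
    (hb : IsQExpansion f b) : b = a := by
  classical
  set t := a.support ∪ b.support with ht
  set d : ℤ → ℕ × ℕ → ℂ := fun k p => b k p - a k p with hd
  have hds : ∀ k, ∀ z : ℍ, Summable fun p : ℕ × ℕ => d k p * nome z ^ p.1 * conj (nome z) ^ p.2 :=
    fun k z => by simpa only [hd, sub_mul] using ((hb z).1 k).sub ((ha z).1 k)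
  have hd0 : ∀ z : ℍ, ∑ k ∈ t,
      LL z ^ k * ∑' p : ℕ × ℕ, d k p * nome z ^ p.1 * conj (nome z) ^ p.2 = 0 := by
    intro z
    have h1 := (hb.eq_sum (t := t) Finset.subset_union_right z).symm.trans
      (ha.eq_sum (t := t) Finset.subset_union_left z)
    rw [← sub_eq_zero, ← Finset.sum_sub_distrib] at h1
    rw [← h1]
    refine Finset.sum_congr rfl fun k _ => ?_
    rw [← mul_sub, ← ((hb z).1 k).tsum_sub ((ha z).1 k)]
    simp only [hd, sub_mul]
  have hmain : ∀ k ∈ t, ∀ N, ∀ p ∈ Finset.HasAntidiagonal.antidiagonal N, d k p = 0 := by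
    intro k hk N
    refine coeff_eq_zero_of_circle fun x => ?_
    set u := Complex.exp (x * Complex.I) with hu
    have hu1 : ‖u‖ = 1 := Complex.norm_exp_ofReal_mul_I x
    -- For fixed phase `u`, grouping by total degree gives a power series in the single variable
    -- `w`, evaluated below at `w = e ^ (-y)`.
    set c : ℤ → ℕ → ℂ := fun k N =>
      ∑ p ∈ Finset.HasAntidiagonal.antidiagonal N, d k p * (u ^ p.1 * conj u ^ p.2) with hc
    have hsum : ∀ k, ∀ w : ℂ, ‖w‖ < 1 → HasSum (fun N => c k N * w ^ N)
        (∑' p : ℕ × ℕ, d k p * ((u * w) ^ p.1 * (conj u * w) ^ p.2)) := by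
      intro k w hw
      have hs := summable_of_summable_norm_lt (hds k) (x := u * w) (y := conj u * w)
        (by simp [hu1]) (by simpa [hu1] using hw)
      have h := (Finset.HasAntidiagonal.sigmaAntidiagonalEquivProd.hasSum_iff.2 hs.hasSum).sigma
        fun n => hasSum_fintype _
      refine h.congr_fun fun N => ?_
      simp only [Finset.univ_eq_attach, Function.comp_def,
        Finset.HasAntidiagonal.sigmaAntidiagonalEquivProd_apply]
      rw [(Finset.HasAntidiagonal.antidiagonal N).sum_attach
        fun p : ℕ × ℕ => d k p * ((u * w) ^ p.1 * (conj u * w) ^ p.2), hc, Finset.sum_mul]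
      refine Finset.sum_congr rfl fun p hp => ?_
      rw [← Finset.HasAntidiagonal.mem_antidiagonal.1 hp]
      ring
    refine coeff_eq_zero_of_sum_log_pow (t := t) (c := c) (fun k w hw => (hsum k w hw).summable)
      (fun y hy => ?_) N k hk
    obtain ⟨z, hLz, hz⟩ := exists_LL_nome x hy
    have hcz : conj (nome z) = conj u * (Real.exp (-y) : ℂ) := by
      rw [hz, map_mul, Complex.conj_ofReal]
    have hnx : ‖(Real.exp (-y) : ℂ)‖ < 1 := by
      rw [Complex.norm_real, Real.norm_of_nonneg (Real.exp_pos _).le]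
      simpa using hy
    rw [← hd0 z]
    refine Finset.sum_congr rfl fun k _ => ?_
    rw [(hsum k _ hnx).tsum_eq, hLz, hcz, hz, ← hu]
    simp only [mul_assoc]
  ext k p
  by_cases hk : k ∈ t
  · exact sub_eq_zero.1 (hmain k hk (p.1 + p.2) p (by simp))
  · simp only [ht, Finset.mem_union, Finsupp.mem_support_iff, not_or, not_not] at hk
    rw [hk.1, hk.2]

theorem mainTheorem5 (r s w : ℕ) (hrs : w = r + s) (hw : 0 < w) (hev : Even w) :
    (∀ z : ℍ, Summable fun p : {p : ℤ × ℤ // p ≠ (0, 0)} => eisTerm r s z p) ∧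
    ∃ a : ℤ →₀ (ℕ × ℕ → ℂ),
      IsQExpansion (realEis r s) a ∧
      (∀ b : ℤ →₀ (ℕ × ℕ → ℂ), IsQExpansion (realEis r s) b → b = a) ∧
      constantPart a =
        LaurentPolynomial.C
            (-(bernoulli (w + 2) : ℂ) / (2 * ((w : ℂ) + 1) * ((w : ℂ) + 2))) *
          LaurentPolynomial.T 1 +
        LaurentPolynomial.C
            ((-1 : ℂ) ^ s / 2 * ((w.factorial : ℂ) / 2 ^ w) * (w.choose r : ℂ) *
              riemannZeta ((w : ℂ) + 1)) *
          LaurentPolynomial.T (-(w : ℤ)) ∧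
      ∀ (k : ℤ) (m n : ℕ), (m, n) ≠ (0, 0) → ∃ c : ℚ, a k (m, n) = (c : ℂ) := by
  refine ⟨fun z => (summable_eisTerm (hrs ▸ hw) z).subtype _, ?_⟩
  obtain ⟨a, ha, hconst, hrat⟩ := hasRatExpansion_realEis hrs hw hev
  exact ⟨a, ha, fun b hb => ha.unique hb, hconst, hrat⟩
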